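/- Let $M_d(\mathbb C)$ be the complex $d\times d$ matrices and $\mathcal S_d\subseteq M_d(\mathbb C)$ the density matrices (positive semidefinite matrices of trace one). A quantum channel is a completely positive, trace preserving linear map $T:M_d(\mathbb C)\to M_n(\mathbb C)$, and its image is $\mathrm{Im}(T)=T(\mathcal S_d)$. A POVM on $\mathbb C^d$ is a tuple $(M_1,\dots,M_k)$ of positive semidefinite matrices in $M_d(\mathbb C)$ with $\sum_i M_i=\mathbb 1$. A linear map $T:M_d(\mathbb C)\to M_n(\mathbb C)$ is called entanglement breaking if $T(\rho)=\sum_{i=1}^k \mathrm{Tr}(M_i\rho)\,\sigma_i$ for all $\rho \in M_d(\mathbb C)$, for some $k$, some POVM $(M_1,\dots,M_k)$ on $\mathbb C^d$ and some density matrices $\sigma_1,\dots,\sigma_k\in\mathcal S_n$. It is called essentially classical-quantum if it has such a representation in which moreover $\|M_i\|=1$ (operator norm) for every $i$. Two quantum channels $T_1:M_{d_1}(\mathbb C)\to M_{n_1}(\mathbb C)$ and $T_2:M_{d_2}(\mathbb C)\to M_{n_2}(\mathbb C)$ are called image additive if $$\mathrm{Im}(T_1\otimes T_2)=\mathrm{conv}\{A\otimes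 B : A\in \mathrm{Im}(T_1),\ B\in\mathrm{Im}(T_2)\}.$$ A quantum channel $T$ is called universally image additive if, for all $d',n'\in\mathbb N$ and all quantum channels $S:M_{d'}(\mathbb C)\to M_{n'}(\mathbb C)$, the channels $T$ and $S$ are image additive. **Theorem.** Let $T:M_d(\mathbb C)\to M_n(\mathbb C)$ be a quantum channel. The following are equivalent: (a) $T$ is universally image additive; (b) $T$ and the identity channel $\mathrm{id}:M_d(\mathbb C)\to M_d(\mathbb C)$ are image additive; (c) there exists an entanglement breaking channel $S:M_d(\mathbb C)\to M_d(\mathbb C)$ such that $T=T\circ S$; (d) there exists an essentially classical-quantum channel $S:M_d(\mathbb C)\to M_d(\mathbb C)$ such that $T=T\circ S$; (e) $T$ is essentially classical-quantum. -/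

import Mathlib

open scoped Matrix Kronecker Matrix.Norms.L2Operator MatrixOrder CStarAlgebra ComplexOrder

namespace QuantumChannels

/-- Linear maps `M_d(ℂ) → M_n(ℂ)`. -/
abbrev MatMap (d n : ℕ) : Type :=
  Matrix (Fin d) (Fin d) ℂ →ₗ[ℂ] Matrix (Fin n) (Fin n) ℂ

/-- Density matrices on `ℂ^ι`: positive semidefinite matrices of trace one. -/
def densityMatrices (ι : Type*) [Fintype ι] : Set (Matrix ι ι ℂ) :=
  {ρ | ρ.PosSemidef ∧ ρ.trace = 1}

/-- A linear map between matrix algebras is completely positive if it is the underlying linear map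
of a completely positive map between the `C⋆`-algebras `M_d(ℂ)` and `M_n(ℂ)`, both with their usual
order (`0 ≤ A` iff `A` is positive semidefinite). -/
def IsCompletelyPositive {d n : ℕ} (T : MatMap d n) : Prop :=
  ∃ Φ : Matrix (Fin d) (Fin d) ℂ →CP Matrix (Fin n) (Fin n) ℂ, Φ.toLinearMap = T

/-- Quantum channels (Schrödinger picture): completely positive and trace preserving maps. -/
structure IsQuantumChannel {d n : ℕ} (T : MatMap d n) : Prop where
  completelyPositive : IsCompletelyPositive T
  tracePreserving : ∀ X, (T X).trace = X.trace

/-- The tuple `(M_1, …, M_k)` is a positive operator valued measure on `ℂ^d`. -/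
structure IsPOVM {d k : ℕ} (M : Fin k → Matrix (Fin d) (Fin d) ℂ) : Prop where
  posSemidef : ∀ i, (M i).PosSemidef
  sum_eq_one : ∑ i, M i = 1

/-- `T` is an entanglement breaking channel: `T(ρ) = ∑ i, Tr(M_i ρ) σ_i` for a POVM `M` and
density matrices `σ_i`. -/
def IsEntanglementBreaking {d n : ℕ} (T : MatMap d n) : Prop :=
  ∃ (k : ℕ) (M : Fin k → Matrix (Fin d) (Fin d) ℂ) (σ : Fin k → Matrix (Fin n) (Fin n) ℂ),
    IsPOVM M ∧ (∀ i, σ i ∈ densityMatrices (Fin n)) ∧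
      ∀ ρ, T ρ = ∑ i, (M i * ρ).trace • σ i

/-- `T` is an essentially classical-quantum channel: `T(ρ) = ∑ i, Tr(M_i ρ) σ_i` for density
matrices `σ_i` and a POVM `M` whose elements all have operator norm one (`‖·‖` is the `ℓ²`-operator
norm on matrices). -/
def IsEssentiallyCQ {d n : ℕ} (T : MatMap d n) : Prop :=
  ∃ (k : ℕ) (M : Fin k → Matrix (Fin d) (Fin d) ℂ) (σ : Fin k → Matrix (Fin n) (Fin n) ℂ),
    IsPOVM M ∧ (∀ i, ‖M i‖ = 1) ∧ (∀ i, σ i ∈ densityMatrices (Fin n)) ∧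
      ∀ ρ, T ρ = ∑ i, (M i * ρ).trace • σ i

/-- The tensor product `T ⊗ S` of two linear maps, acting on `M_d(ℂ) ⊗ M_d'(ℂ)` realised as the
matrices indexed by `Fin d × Fin d'` through the Kronecker product. -/
noncomputable def tensorMap {d n d' n' : ℕ} (T : MatMap d n) (S : MatMap d' n') :
    Matrix (Fin d × Fin d') (Fin d × Fin d') ℂ →ₗ[ℂ]
      Matrix (Fin n × Fin n') (Fin n × Fin n') ℂ :=
  (kroneckerLinearEquiv (Fin n) (Fin n) (Fin n') (Fin n') ℂ).toLinearMap ∘ₗ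
    TensorProduct.map T S ∘ₗ
      (kroneckerLinearEquiv (Fin d) (Fin d) (Fin d') (Fin d') ℂ).symm.toLinearMap

theorem tensorMap_kronecker {d n d' n' : ℕ} (T : MatMap d n) (S : MatMap d' n')
    (A : Matrix (Fin d) (Fin d) ℂ) (B : Matrix (Fin d') (Fin d') ℂ) :
    tensorMap T S (A ⊗ₖ B) = T A ⊗ₖ S B := by
  simp [tensorMap]

/-- The image of a channel: the set of its values on density matrices. -/
def channelImage {ι κ : Type*} [Fintype ι] (T : Matrix ι ι ℂ →ₗ[ℂ] Matrix κ κ ℂ) :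
    Set (Matrix κ κ ℂ) :=
  T '' densityMatrices ι

/-- `T` and `S` are image additive: the image of `T ⊗ S` is the convex hull of the set of tensor
products of elements of the images of `T` and `S`. -/
def ImageAdditive {d n d' n' : ℕ} (T : MatMap d n) (S : MatMap d' n') : Prop :=
  channelImage (tensorMap T S) =
    convexHull ℝ (Set.image2 (fun A B => A ⊗ₖ B) (channelImage T) (channelImage S))

/-- `T` is universally image additive: it is image additive with every quantum channel. -/
def UniversallyImageAdditive {d n : ℕ} (T : MatMap d n) : Prop :=
  ∀ (d' n' : ℕ) (S : MatMap d' n'), IsQuantumChannel S → ImageAdditive T S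

end QuantumChannels

open QuantumChannels

/-! ### Positive semidefinite and density matrices -/

section PosSemidef

variable {ι κ : Type*}

theorem Complex.real_smul_matrix (r : ℝ) (A : Matrix ι κ ℂ) : r • A = (r : ℂ) • A := by
  ext i j
  simp

variable [Fintype ι] [Fintype κ]

theorem Matrix.PosSemidef.trace_mul_nonneg [DecidableEq ι] {A B : Matrix ι ι ℂ}
    (hA : A.PosSemidef) (hB : B.PosSemidef) : 0 ≤ (A * B).trace := by
  obtain ⟨C, rfl⟩ := CStarAlgebra.nonneg_iff_eq_star_mul_self.mp hA.nonneg
  rw [Matrix.star_eq_conjTranspose]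
  rw [Matrix.mul_assoc, Matrix.trace_mul_comm]
  exact (hB.mul_mul_conjTranspose_same C).trace_nonneg

theorem convex_densityMatrices : Convex ℝ (densityMatrices ι) := by
  rintro A ⟨hA, hA'⟩ B ⟨hB, hB'⟩ a b ha hb hab
  refine ⟨?_, ?_⟩
  · rw [Complex.real_smul_matrix, Complex.real_smul_matrix]
    exact (hA.smul (Complex.zero_le_real.mpr ha)).add (hB.smul (Complex.zero_le_real.mpr hb))
  · rw [Complex.real_smul_matrix, Complex.real_smul_matrix, Matrix.trace_add, Matrix.trace_smul,
      Matrix.trace_smul, hA', hB']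
    simpa using congrArg Complex.ofReal hab

theorem convex_channelImage {κ : Type*} (T : Matrix ι ι ℂ →ₗ[ℂ] Matrix κ κ ℂ) :
    Convex ℝ (channelImage T) :=
  convex_densityMatrices.linear_image (T.restrictScalars ℝ)

theorem kronecker_mem_densityMatrices [DecidableEq ι] [DecidableEq κ] {A : Matrix ι ι ℂ}
    {B : Matrix κ κ ℂ} (hA : A ∈ densityMatrices ι) (hB : B ∈ densityMatrices κ) :
    A ⊗ₖ B ∈ densityMatrices (ι × κ) :=
  ⟨hA.1.kronecker hB.1, by rw [Matrix.trace_kronecker, hA.2, hB.2, one_mul]⟩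

theorem Matrix.PosSemidef.exists_smul_densityMatrix {X : Matrix ι ι ℂ} (hX : X.PosSemidef)
    (h : X.trace ≠ 0) : ∃ ρ ∈ densityMatrices ι, X = X.trace.re • ρ := by
  have hre : (X.trace.re : ℂ) = X.trace := 
    Complex.ext rfl (by simpa using (Complex.nonneg_iff.mp hX.trace_nonneg).2)
  have hre0 : 0 ≤ X.trace.re := (Complex.nonneg_iff.mp hX.trace_nonneg).1
  have hne : X.trace.re ≠ 0 := fun h0 => h (by rw [← hre, h0, Complex.ofReal_zero])
  refine ⟨X.trace.re⁻¹ • X, ⟨?_, ?_⟩, by rw [smul_smul, mul_inv_cancel₀ hne, one_smul]⟩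
  · rw [Complex.real_smul_matrix]
    exact hX.smul (Complex.zero_le_real.mpr (inv_nonneg.mpr hre0))
  · rw [Complex.real_smul_matrix, Matrix.trace_smul, Complex.ofReal_inv, hre, smul_eq_mul,
      inv_mul_cancel₀ h]

end PosSemidef

/-! ### Channels, POVMs and effects of norm one -/

namespace QuantumChannels

variable {d n d' n' k : ℕ}

theorem IsQuantumChannel.map_posSemidef {T : MatMap d n} (hT : IsQuantumChannel T)
    {X : Matrix (Fin d) (Fin d) ℂ} (hX : X.PosSemidef) : (T X).PosSemidef := by
  obtain ⟨Φ, rfl⟩ := hT.completelyPositive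
  exact Matrix.nonneg_iff_posSemidef.mp (map_nonneg Φ hX.nonneg)

theorem IsQuantumChannel.map_densityMatrix {T : MatMap d n} (hT : IsQuantumChannel T)
    {X : Matrix (Fin d) (Fin d) ℂ} (hX : X ∈ densityMatrices (Fin d)) :
    T X ∈ densityMatrices (Fin n) :=
  ⟨hT.map_posSemidef hX.1, (hT.tracePreserving X).trans hX.2⟩

theorem isQuantumChannel_id : IsQuantumChannel (LinearMap.id : MatMap d d) where
  completelyPositive := ⟨⟨LinearMap.id, fun _ _ hM => hM⟩, rfl⟩
  tracePreserving _ := rfl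

theorem IsPOVM.le_one {M : Fin k → Matrix (Fin d) (Fin d) ℂ} (hM : IsPOVM M) (i : Fin k) :
    M i ≤ 1 := by
  rw [← hM.sum_eq_one]
  exact Finset.single_le_sum (fun j _ => (hM.posSemidef j).nonneg) (Finset.mem_univ i)

theorem IsPOVM.sum_trace_mul {M : Fin k → Matrix (Fin d) (Fin d) ℂ} (hM : IsPOVM M)
    (X : Matrix (Fin d) (Fin d) ℂ) : ∑ i, (M i * X).trace = X.trace := by
  rw [← Matrix.trace_sum, ← Finset.sum_mul, hM.sum_eq_one, one_mul]

/-- Pairing A ≤ ‖A‖·1 with ρ gives 1 ≤ ‖A‖. -/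
theorem norm_eq_one_of_trace_mul_eq_one {A ρ : Matrix (Fin d) (Fin d) ℂ} (hA : A.PosSemidef)
    (hA1 : A ≤ 1) (hρ : ρ ∈ densityMatrices (Fin d)) (h : (A * ρ).trace = 1) : ‖A‖ = 1 := by
  refine le_antisymm ((CStarAlgebra.norm_le_one_iff_of_nonneg A hA.nonneg).mpr hA1) ?_
  have hle : A ≤ algebraMap ℝ _ ‖A‖ := IsSelfAdjoint.le_algebraMap_norm_self hA.1
  have := (Matrix.le_iff.mp hle).trace_mul_nonneg hρ.1
  rw [sub_mul, Matrix.trace_sub, h, Algebra.algebraMap_eq_smul_one, smul_mul_assoc, one_mul,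
    Matrix.trace_smul, hρ.2, sub_nonneg] at this
  simpa using (Complex.le_def.mp this).1

/-- The norm of a positive matrix lies in its spectrum, so the normalized projector onto an
eigenvector for 1 works. -/
theorem exists_densityMatrix_trace_mul_eq_one {A : Matrix (Fin d) (Fin d) ℂ} (hA : A.PosSemidef)
    (h : ‖A‖ = 1) : ∃ ρ ∈ densityMatrices (Fin d), (A * ρ).trace = 1 := by
  have : Nontrivial (Matrix (Fin d) (Fin d) ℂ) :=
    ⟨A, 0, fun h0 => by simp [h0] at h⟩
  have hmem : (1 : ℂ) ∈ spectrum ℂ A := by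
    have := CStarAlgebra.norm_mem_spectrum_of_nonneg (a := A) hA.nonneg
    rw [h] at this
    simpa using (spectrum.algebraMap_mem_iff ℂ).mpr this
  rw [← Matrix.spectrum_toLin', ← Module.End.hasEigenvalue_iff_mem_spectrum] at hmem
  obtain ⟨v, hv⟩ := hmem.exists_hasEigenvector
  have hAv : A *ᵥ v = v := by simpa using hv.apply_eq_smul
  have hX := Matrix.posSemidef_vecMulVec_self_star v
  have hne : (Matrix.vecMulVec v (star v)).trace ≠ 0 := by
    rw [Matrix.trace_vecMulVec]
    simpa using hv.2
  obtain ⟨ρ, hρ, hXρ⟩ := hX.exists_smul_densityMatrix hne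
  refine ⟨ρ, hρ, ?_⟩
  have hAX : A * Matrix.vecMulVec v (star v) = Matrix.vecMulVec v (star v) := by
    rw [Matrix.mul_vecMulVec, hAv]
  have hr : (Matrix.vecMulVec v (star v)).trace.re ≠ 0 := fun h0 => hne (by
    rw [hXρ, h0, zero_smul, Matrix.trace_zero])
  have hAρ : A * ρ = ρ := by
    rw [hXρ, Matrix.mul_smul] at hAX
    exact smul_right_injective _ hr hAX
  rw [hAρ, hρ.2]

/-- An essentially classical-quantum channel factors through a measure-and-prepare channel whose
prepared states are perfectly distinguished by the measurement. -/
theorem IsEssentiallyCQ.exists_eq_comp {T : MatMap d n} (hT : IsEssentiallyCQ T) :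
    ∃ S : MatMap d d, IsEssentiallyCQ S ∧ T = T ∘ₗ S := by
  obtain ⟨k, M, σ, hM, hnorm, hσ, hrep⟩ := hT
  choose ρ hρ hρM using fun i => exists_densityMatrix_trace_mul_eq_one (hM.posSemidef i) (hnorm i)
  have hTρ : ∀ j, T (ρ j) = σ j := by
    intro j
    -- Outcome j is certain on `ρ j`, so every other outcome has probability zero.
    have hsum : ∑ i ∈ Finset.univ.erase j, (M i * ρ j).trace = 0 := by
      have := hM.sum_trace_mul (ρ j)
      rw [← Finset.add_sum_erase _ _ (Finset.mem_univ j), hρM, (hρ j).2] at this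
      simpa using this
    rw [Finset.sum_eq_zero_iff_of_nonneg
      fun i _ => (hM.posSemidef i).trace_mul_nonneg (hρ j).1] at hsum
    rw [hrep, Finset.sum_eq_single j, hρM, one_smul]
    · intro i _ hij
      rw [hsum i (Finset.mem_erase.mpr ⟨hij, Finset.mem_univ i⟩), zero_smul]
    · simp
  let S : MatMap d d := ∑ i, ((Matrix.traceLinearMap (Fin d) ℂ ℂ) ∘ₗ
    LinearMap.mulLeft ℂ (M i)).smulRight (ρ i)
  have hS : ∀ X, S X = ∑ i, (M i * X).trace • ρ i := fun X => by
    simp [S, LinearMap.sum_apply]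
  refine ⟨S, ⟨k, M, ρ, hM, hnorm, hρ, hS⟩, LinearMap.ext fun X => ?_⟩
  rw [LinearMap.comp_apply, hS, map_sum, hrep X]
  simp only [map_smul, hTρ]

theorem IsEssentiallyCQ.isEntanglementBreaking {T : MatMap d n} (hT : IsEssentiallyCQ T) :
    IsEntanglementBreaking T := by
  obtain ⟨k, M, σ, hM, -, hσ, hrep⟩ := hT
  exact ⟨k, M, σ, hM, hσ, hrep⟩

/-! ### Minimizing the number of outcomes -/

/-- `T` factors as `T ∘ S` for a measure-and-prepare channel `S` with `k` outcomes. -/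
def FactorsWithOutcomes (T : MatMap d n) (k : ℕ) : Prop :=
  ∃ (M : Fin k → Matrix (Fin d) (Fin d) ℂ) (σ : Fin k → Matrix (Fin d) (Fin d) ℂ),
    IsPOVM M ∧ (∀ i, σ i ∈ densityMatrices (Fin d)) ∧
      ∀ ρ, T ρ = ∑ i, (M i * ρ).trace • T (σ i)

/-- If one of the prepared states is not detected with certainty, the corresponding outcome can be
redistributed among the others. -/
theorem FactorsWithOutcomes.reduce {T : MatMap d n}
    {M : Fin (k + 1) → Matrix (Fin d) (Fin d) ℂ} {σ : Fin (k + 1) → Matrix (Fin d) (Fin d) ℂ}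
    (hM : IsPOVM M) (hσ : ∀ i, σ i ∈ densityMatrices (Fin d))
    (hrep : ∀ ρ, T ρ = ∑ i, (M i * ρ).trace • T (σ i)) (j : Fin (k + 1))
    (hj : (M j * σ j).trace ≠ 1) : FactorsWithOutcomes T k := by
  set q : Fin (k + 1) → ℂ := fun i => (M i * σ j).trace with hq
  have hq0 : ∀ i, 0 ≤ q i := fun i => (hM.posSemidef i).trace_mul_nonneg (hσ j).1
  have hsum : q j + ∑ i, q (j.succAbove i) = 1 := by
    rw [← Fin.sum_univ_succAbove q j, hq, hM.sum_trace_mul, (hσ j).2]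
  have hne : 1 - q j ≠ 0 := sub_ne_zero.mpr (Ne.symm hj)
  have hpos : 0 ≤ 1 - q j := by
    rw [← hsum, add_sub_cancel_left]
    exact Finset.sum_nonneg fun i _ => hq0 _
  have hinv : 0 ≤ (1 - q j)⁻¹ := inv_nonneg_of_nonneg hpos
  have hw0 : ∀ i, 0 ≤ (1 - q j)⁻¹ * q (j.succAbove i) := fun i => mul_nonneg hinv (hq0 _)
  have hw1 : ∑ i, (1 - q j)⁻¹ * q (j.succAbove i) = 1 := by
    rw [← Finset.mul_sum, eq_sub_of_add_eq' hsum, inv_mul_cancel₀ hne]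
  -- Evaluate the representation at `σ j` and solve for `T (σ j)`, whose coefficient there is `q j ≠
  -- 1`.
  have hF : T (σ j) = ∑ i, ((1 - q j)⁻¹ * q (j.succAbove i)) • T (σ (j.succAbove i)) := by
    have h := hrep (σ j)
    rw [Fin.sum_univ_succAbove _ j] at h
    simp only [mul_smul, ← Finset.smul_sum]
    rw [eq_inv_smul_iff₀ hne, sub_smul, one_smul, sub_eq_iff_eq_add']
    exact h
  -- The effect `M j` is shared out with the weights of this convex combination.
  refine ⟨fun i => M (j.succAbove i) + ((1 - q j)⁻¹ * q (j.succAbove i)) • M j,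
    fun i => σ (j.succAbove i), ⟨fun i => (hM.posSemidef _).add ((hM.posSemidef j).smul (hw0 i)),
    ?_⟩, fun i => hσ _, fun ρ => ?_⟩
  · rw [Finset.sum_add_distrib, ← Finset.sum_smul, hw1, one_smul, add_comm,
      ← Fin.sum_univ_succAbove M j, hM.sum_eq_one]
  · simp only [add_mul, Matrix.trace_add, smul_mul_assoc, Matrix.trace_smul, add_smul,
      Finset.sum_add_distrib]
    rw [hrep ρ, Fin.sum_univ_succAbove _ j, hF, Finset.smul_sum, add_comm]
    simp only [smul_smul, smul_eq_mul, mul_comm]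

theorem IsQuantumChannel.isEssentiallyCQ_of_eq_comp {T : MatMap d n} (hT : IsQuantumChannel T)
    {S : MatMap d d} (hS : IsEntanglementBreaking S) (hTS : T = T ∘ₗ S) : IsEssentiallyCQ T := by
  classical
  have hex : ∃ k, FactorsWithOutcomes T k := by
    obtain ⟨k, M, σ, hM, hσ, hrep⟩ := hS
    refine ⟨k, M, σ, hM, hσ, fun ρ => ?_⟩
    conv_lhs => rw [hTS]
    simp [hrep]
  obtain ⟨M, σ, hM, hσ, hrep⟩ := Nat.find_spec hex
  have hmin : ∀ m < Nat.find hex, ¬ FactorsWithOutcomes T m := fun m hm => Nat.find_min hex hm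
  generalize Nat.find hex = k at M σ hM hσ hrep hmin
  refine ⟨k, M, fun i => T (σ i), hM, fun j => ?_, fun i => hT.map_densityMatrix (hσ i), hrep⟩
  refine norm_eq_one_of_trace_mul_eq_one (hM.posSemidef j) (hM.le_one j) (hσ j) ?_
  by_contra hj
  obtain _ | m := k
  · exact j.elim0
  · exact hmin m m.lt_succ_self (FactorsWithOutcomes.reduce hM hσ hrep j hj)

/-! ### Slices and universal image additivity -/

/-- The slice map `A ⊗ B ↦ Tr(M A) B`. -/
def sliceMap (M : Matrix (Fin d) (Fin d) ℂ) :
    Matrix (Fin d × Fin d') (Fin d × Fin d') ℂ →ₗ[ℂ] Matrix (Fin d') (Fin d') ℂ where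
  toFun X := Matrix.of fun i j => ∑ a, ∑ b, M a b * X (b, i) (a, j)
  map_add' X Y := by
    ext i j
    simp [mul_add, Finset.sum_add_distrib]
  map_smul' c X := by
    ext i j
    simp [Finset.mul_sum, mul_left_comm]

theorem sliceMap_kronecker (M A : Matrix (Fin d) (Fin d) ℂ) (B : Matrix (Fin d') (Fin d') ℂ) :
    sliceMap M (A ⊗ₖ B) = (M * A).trace • B := by
  ext i j
  simp [sliceMap, Matrix.trace, Matrix.mul_apply, Finset.sum_mul, mul_assoc]

/-- With M = CᴴC, the slice has the Kraus form ∑ B_eᴴ X B_e, where B_e is the conjugated row e of C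
tensored with the identity. -/
theorem sliceMap_posSemidef {M : Matrix (Fin d) (Fin d) ℂ} (hM : M.PosSemidef)
    {X : Matrix (Fin d × Fin d') (Fin d × Fin d') ℂ} (hX : X.PosSemidef) :
    (sliceMap M X).PosSemidef := by
  obtain ⟨C, rfl⟩ := CStarAlgebra.nonneg_iff_eq_star_mul_self.mp hM.nonneg
  rw [Matrix.star_eq_conjTranspose]
  let B : Fin d → Matrix (Fin d × Fin d') (Fin d') ℂ :=
    fun e => Matrix.of fun p j => if p.2 = j then star (C e p.1) else 0
  have : sliceMap (Cᴴ * C) X = ∑ e, (B e)ᴴ * X * B e := by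
    ext i j
    simp only [sliceMap, LinearMap.coe_mk, AddHom.coe_mk, Matrix.of_apply, Matrix.sum_apply,
      Matrix.mul_apply, Matrix.conjTranspose_apply, B, Fintype.sum_prod_type, Finset.sum_mul,
      apply_ite star, star_star, star_zero, ite_mul, zero_mul, mul_ite, mul_zero,
      Finset.sum_ite_eq', Finset.mem_univ, if_true]
    rw [Finset.sum_congr rfl fun a _ => Finset.sum_comm, Finset.sum_comm]
    refine Finset.sum_congr rfl fun e _ => Finset.sum_congr rfl fun a _ =>
      Finset.sum_congr rfl fun b _ => by ring
  rw [this]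
  exact Matrix.posSemidef_sum _ fun e _ => hX.conjTranspose_mul_mul_same (B e)

theorem sum_trace_sliceMap {M : Fin k → Matrix (Fin d) (Fin d) ℂ} (hM : IsPOVM M)
    (X : Matrix (Fin d × Fin d') (Fin d × Fin d') ℂ) :
    ∑ i, (sliceMap (M i) X).trace = X.trace := by
  have hsum : ∀ a b, ∑ i, M i a b = (1 : Matrix (Fin d) (Fin d) ℂ) a b := fun a b => by
    rw [← hM.sum_eq_one, Matrix.sum_apply]
  simp only [Matrix.trace, Matrix.diag, sliceMap, LinearMap.coe_mk, AddHom.coe_mk, Matrix.of_apply]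
  rw [Finset.sum_comm, Fintype.sum_prod_type, Finset.sum_comm (s := (Finset.univ : Finset (Fin d)))]
  refine Finset.sum_congr rfl fun l _ => ?_
  rw [Finset.sum_comm]
  refine Finset.sum_congr rfl fun a _ => ?_
  rw [Finset.sum_comm]
  simp only [← Finset.sum_mul, hsum, Matrix.one_apply, ite_mul, one_mul, zero_mul,
    Finset.sum_ite_eq, Finset.mem_univ, if_true]

theorem linearMap_ext_kronecker {V : Type*} [AddCommGroup V] [Module ℂ V]
    {f g : Matrix (Fin d × Fin d') (Fin d × Fin d') ℂ →ₗ[ℂ] V}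
    (h : ∀ A B, f (A ⊗ₖ B) = g (A ⊗ₖ B)) : f = g := by
  refine (LinearEquiv.eq_comp_toLinearMap_iff (e₁₂ := kroneckerLinearEquiv _ _ _ _ ℂ) f g).mp ?_
  exact TensorProduct.ext' fun A B => by simpa using h A B

theorem tensorMap_eq_sum {T : MatMap d n} {M : Fin k → Matrix (Fin d) (Fin d) ℂ}
    {τ : Fin k → Matrix (Fin n) (Fin n) ℂ} (hrep : ∀ ρ, T ρ = ∑ i, (M i * ρ).trace • τ i)
    (R : MatMap d' n') (X : Matrix (Fin d × Fin d') (Fin d × Fin d') ℂ) :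
    tensorMap T R X = ∑ i, τ i ⊗ₖ R (sliceMap (M i) X) := by
  let g : Matrix (Fin d × Fin d') (Fin d × Fin d') ℂ →ₗ[ℂ] Matrix (Fin n × Fin n')
      (Fin n × Fin n') ℂ :=
    ∑ i, (Matrix.kroneckerBilinear (R := ℂ) (τ i)) ∘ₗ R ∘ₗ sliceMap (M i)
  have hg : ∀ Y, g Y = ∑ i, τ i ⊗ₖ R (sliceMap (M i) Y) := fun Y => by
    simp only [g, LinearMap.sum_apply, LinearMap.comp_apply]
    rfl
  rw [← hg]
  refine LinearMap.congr_fun (linearMap_ext_kronecker fun A B => ?_) X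
  rw [tensorMap_kronecker, hg, hrep]
  simp only [sliceMap_kronecker, map_smul]
  ext p q
  simp [Matrix.sum_apply, Finset.sum_mul, mul_left_comm, mul_assoc]

theorem convexHull_subset_channelImage_tensorMap (T : MatMap d n) (R : MatMap d' n') :
    convexHull ℝ (Set.image2 (fun A B => A ⊗ₖ B) (channelImage T) (channelImage R)) ⊆
      channelImage (tensorMap T R) := by
  refine convexHull_min ?_ (convex_channelImage _)
  rintro _ ⟨_, ⟨A, hA, rfl⟩, _, ⟨B, hB, rfl⟩, rfl⟩
  exact ⟨A ⊗ₖ B, kronecker_mem_densityMatrices hA hB, tensorMap_kronecker T R A B⟩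

theorem universallyImageAdditive_of_eq_comp {T : MatMap d n} {S : MatMap d d}
    (hS : IsEntanglementBreaking S) (hTS : T = T ∘ₗ S) : UniversallyImageAdditive T := by
  intro d' n' R _
  refine Set.Subset.antisymm ?_ (convexHull_subset_channelImage_tensorMap T R)
  rintro _ ⟨X, hX, rfl⟩
  obtain ⟨k, M, σ, hM, hσ, hrep⟩ := hS
  have hrepT : ∀ ρ, T ρ = ∑ i, (M i * ρ).trace • T (σ i) := fun ρ => by
    conv_lhs => rw [hTS]
    simp [hrep]
  have hps : ∀ i, (sliceMap (M i) X).PosSemidef := fun i =>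
    sliceMap_posSemidef (hM.posSemidef i) hX.1
  -- A slice of trace zero vanishes; the junk value 0 then stands in for its state, since membership
  -- in the hull is needed only for nonzero weights.
  have hex : ∀ i, ∃ ρ, ((sliceMap (M i) X).trace.re ≠ 0 → ρ ∈ densityMatrices (Fin d')) ∧
      sliceMap (M i) X = (sliceMap (M i) X).trace.re • ρ := by
    intro i
    by_cases h : (sliceMap (M i) X).trace = 0
    · exact ⟨0, by simp [h], by simp [(hps i).trace_eq_zero_iff.mp h]⟩
    · obtain ⟨ρ, hρ, h'⟩ := (hps i).exists_smul_densityMatrix h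
      exact ⟨ρ, fun _ => hρ, h'⟩
  choose ρ hρ hXρ using hex
  have hval : tensorMap T R X =
      ∑ i, (sliceMap (M i) X).trace.re • (T (σ i) ⊗ₖ R (ρ i)) := by
    rw [tensorMap_eq_sum hrepT]
    refine Finset.sum_congr rfl fun i _ => ?_
    conv_lhs => rw [hXρ i]
    rw [Complex.real_smul_matrix, Complex.real_smul_matrix, map_smul, Matrix.kronecker_smul]
  rw [hval, ← finsum_eq_sum_of_fintype]
  refine (convex_convexHull ℝ _).finsum_mem
    (fun i => (Complex.nonneg_iff.mp (hps i).trace_nonneg).1) ?_ fun i hi => ?_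
  · rw [finsum_eq_sum_of_fintype, ← Complex.re_sum, sum_trace_sliceMap hM, hX.2, Complex.one_re]
  · exact subset_convexHull _ _ ⟨_, ⟨_, hσ i, rfl⟩, _, ⟨_, hρ i hi, rfl⟩, rfl⟩

/-! ### The Choi matrix and image additivity with the identity -/

/-- The maximally entangled vector, up to normalization. -/
def maxEntangledVec (d : ℕ) : Fin d × Fin d → ℂ := fun p => if p.1 = p.2 then 1 else 0

theorem tensorMap_id_maxEntangled_apply (T : MatMap d n) (a b : Fin n) (i j : Fin d) :
    tensorMap T (LinearMap.id : MatMap d d)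
      (Matrix.vecMulVec (maxEntangledVec d) (star (maxEntangledVec d))) (a, i) (b, j) =
      T (Matrix.single i j 1) a b := by
  have : Matrix.vecMulVec (maxEntangledVec d) (star (maxEntangledVec d)) =
      ∑ i : Fin d, ∑ j : Fin d, Matrix.single i j (1 : ℂ) ⊗ₖ Matrix.single i j (1 : ℂ) := by
    ext ⟨a, b⟩ ⟨a', b'⟩
    simp [Matrix.vecMulVec_apply, maxEntangledVec, Matrix.sum_apply, Matrix.single_apply, ite_and,
      apply_ite, eq_comm]
    grind
  rw [this]
  simp only [map_sum, tensorMap_kronecker, Matrix.sum_apply, LinearMap.id_apply]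
  rw [Finset.sum_eq_single i, Finset.sum_eq_single j]
  · simp
  · intro j' _ h
    simp [h]
  · simp
  · intro i' _ h
    simp [h]
  · simp

theorem isEntanglementBreaking_of_fintype {ι : Type} [Fintype ι] {T : MatMap d n}
    {M : ι → Matrix (Fin d) (Fin d) ℂ} {σ : ι → Matrix (Fin n) (Fin n) ℂ}
    (hM : ∀ i, (M i).PosSemidef) (hM1 : ∑ i, M i = 1) (hσ : ∀ i, σ i ∈ densityMatrices (Fin n))
    (hrep : ∀ ρ, T ρ = ∑ i, (M i * ρ).trace • σ i) : IsEntanglementBreaking T := by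
  let e := (Fintype.equivFin ι).symm
  refine ⟨Fintype.card ι, M ∘ e, σ ∘ e, ⟨fun i => hM _, ?_⟩, fun i => hσ _, fun ρ => ?_⟩
  · rw [← hM1]
    exact e.sum_comp M
  · rw [hrep]
    exact (e.sum_comp fun i => (M i * ρ).trace • σ i).symm

theorem exists_eq_comp_of_imageAdditive_id {T : MatMap d n} (hT : ∀ X, (T X).trace = X.trace)
    (h : ImageAdditive T (LinearMap.id : MatMap d d)) :
    ∃ S : MatMap d d, IsEntanglementBreaking S ∧ T = T ∘ₗ S := by
  -- For d = 0 there is no state, but the empty POVM works because 0 = 1.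
  obtain rfl | hd := Nat.eq_zero_or_pos d
  · refine ⟨0, ⟨0, Fin.elim0, Fin.elim0, ⟨fun i => i.elim0, Subsingleton.elim _ _⟩,
      fun i => i.elim0, fun ρ => Subsingleton.elim _ _⟩, ?_⟩
    ext1 X
    rw [Subsingleton.elim X 0, map_zero, map_zero]
  have hd0 : (d : ℝ) ≠ 0 := by positivity
  have hω : (d : ℝ)⁻¹ • Matrix.vecMulVec (maxEntangledVec d) (star (maxEntangledVec d)) ∈
      densityMatrices (Fin d × Fin d) := by
    rw [Complex.real_smul_matrix]
    refine ⟨(Matrix.posSemidef_vecMulVec_self_star _).smul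
      (Complex.zero_le_real.mpr (by positivity)), ?_⟩
    rw [Matrix.trace_smul, Matrix.trace_vecMulVec]
    simp [dotProduct, maxEntangledVec, Fintype.sum_prod_type, hd.ne']
  have hmem := Set.mem_image_of_mem (tensorMap T (LinearMap.id : MatMap d d)) hω
  change _ ∈ channelImage _ at hmem
  rw [h, mem_convexHull_iff_exists_fintype] at hmem
  obtain ⟨ι, _, w, z, hw0, hw1, hz, hsum⟩ := hmem
  choose A hA B hB hAB using hz
  choose ρ hρ hρA using hA
  choose B' hB' hBB using hB
  obtain rfl : B' = B := funext hBB
  have hentry : ∀ (i j : Fin d), T (Matrix.single i j 1) =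
      ∑ c, ((d : ℂ) * w c * B' c i j) • T (ρ c) := by
    intro i j
    ext a b
    have := congrFun (congrFun hsum (a, i)) (b, j)
    rw [Complex.real_smul_matrix, map_smul, Matrix.smul_apply, tensorMap_id_maxEntangled_apply,
      Matrix.sum_apply] at this
    have hd1 : (d : ℂ) ≠ 0 := by exact_mod_cast hd.ne'
    rw [smul_eq_mul, Complex.ofReal_inv, Complex.ofReal_natCast, eq_inv_mul_iff_mul_eq₀ hd1] at this
    rw [← this, Matrix.sum_apply, Finset.mul_sum]
    refine Finset.sum_congr rfl fun c _ => ?_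
    rw [← hAB c, ← hρA c]
    simp
    ring
  -- The factor d undoes the normalization of the entangled state; the transpose appears because
  -- Tr(M E_ij) = M_ji.
  let M : ι → Matrix (Fin d) (Fin d) ℂ := fun c => ((d : ℂ) * w c) • (B' c)ᵀ
  have htr : ∀ c i j, (M c * Matrix.single i j 1).trace = (d : ℂ) * w c * B' c i j := by
    intro c i j
    simp [M, Matrix.trace_mul_single]
  let S : MatMap d d := ∑ c, ((Matrix.traceLinearMap (Fin d) ℂ ℂ) ∘ₗ
    LinearMap.mulLeft ℂ (M c)).smulRight (ρ c)
  have hS : ∀ X, S X = ∑ c, (M c * X).trace • ρ c := fun X => by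
    simp [S, LinearMap.sum_apply]
  refine ⟨S, isEntanglementBreaking_of_fintype (M := M) (σ := ρ) (fun c => ?_) ?_ hρ hS, ?_⟩
  · refine (hB' c).1.transpose.smul ?_
    exact mul_nonneg (Nat.cast_nonneg d) (Complex.zero_le_real.mpr (hw0 c))
  -- Completeness of the POVM is trace preservation of T on matrix units.
  · ext i j
    have h1 := hT (Matrix.single j i 1)
    rw [hentry, Matrix.trace_sum] at h1
    simp only [Matrix.trace_smul, hT, (hρ _).2, smul_eq_mul, mul_one] at h1
    rw [Matrix.sum_apply]
    simp only [M, Matrix.smul_apply, Matrix.transpose_apply, smul_eq_mul, h1]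
    by_cases hij : i = j
    · rw [hij, Matrix.one_apply_eq, Matrix.trace_single_eq_same]
    · rw [Matrix.one_apply_ne hij, Matrix.trace_single_eq_of_ne _ _ _ (Ne.symm hij)]
  · refine Matrix.ext_linearMap ℂ fun i j => LinearMap.ext_ring ?_
    simp only [LinearMap.comp_apply, Matrix.singleLinearMap_apply, hS, map_sum, map_smul, htr,
      hentry]

end QuantumChannels

theorem mainTheorem1 {d n : ℕ} (T : QuantumChannels.MatMap d n)
    (hT : QuantumChannels.IsQuantumChannel T) :
    List.TFAE
      [QuantumChannels.UniversallyImageAdditive T,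
        QuantumChannels.ImageAdditive T
          (LinearMap.id : QuantumChannels.MatMap d d),
        ∃ S : QuantumChannels.MatMap d d,
          QuantumChannels.IsEntanglementBreaking S ∧ T = T ∘ₗ S,
        ∃ S : QuantumChannels.MatMap d d,
          QuantumChannels.IsEssentiallyCQ S ∧ T = T ∘ₗ S,
        QuantumChannels.IsEssentiallyCQ T] := by
  tfae_have 1 → 2 := fun h => h d d LinearMap.id isQuantumChannel_id
  tfae_have 2 → 3 := exists_eq_comp_of_imageAdditive_id hT.tracePreserving
  tfae_have 3 → 1 := fun ⟨_, hS, h⟩ => universallyImageAdditive_of_eq_comp hS h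
  tfae_have 3 → 5 := fun ⟨_, hS, h⟩ => hT.isEssentiallyCQ_of_eq_comp hS h
  tfae_have 5 → 4 := fun h => h.exists_eq_comp
  tfae_have 4 → 3 := fun ⟨S, hS, h⟩ => ⟨S, hS.isEntanglementBreaking, h⟩
  tfae_finish
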